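/- Let $\Gamma$ be a finite extensive-form game with perfect recall, with a finite set $N$ of players, a chance player $c$ (whose information sets also satisfy perfect recall), $N_c=N\cup\{c\}$, terminal histories $Z$ and payoffs $u^i_z:Z\to\mathbb R$, $i\in N$. For $i\in N_c$ let $I_i^j$, $j\in M_i$, be the information sets of $i$, let $A(I_i^j)$ be the set of actions at $I_i^j$, let $\varpi^i_h$ be the sequence of moves (actions together with the information sets at which they are taken) of $i$ along a history $h$, let $\varpi^i_{I_i^j}$ be the sequence of $i$ leading to $I_i^j$, and let $W^i=\{\emptyset\}\cup\{\varpi^i_{I_i^j}a : j\in M_i,\ a\in A(I_i^j)\}$ be the set of sequences of $i$. *Normal form.* Let $S^i$ be the set of pure strategies of $i\in N_c$ in the reduced normal form: $s^i\in S^i$ chooses one action at each information set of $i$ that is not excluded by the earlier choices of $s^i$ itself, and none at the others. For a sequence $\varpi^i$ let $s^i(\varpi^i)=1$ if $s^i$ chooses all actions of $\varpi^i$ and $s^i(\varpi^i)=0$ otherwise. A pure strategy profile $s=(s^i)_{i\in N_c}$ gives player $i\in N$ the payoff $u^i(s)$, the sum of $u^i_z(z)$ over the terminal histories $z$ all of whose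 actions are chosen by $s$. Let $\sigma^c(s^c)$ be the product of the chance probabilities of the actions chosen by $s^c$, and for a profile $\sigma=(\sigma^i)_{i\in N}$ of mixed strategies (probability distributions $\sigma^i$ on $S^i$) let $u^i(s^i,\sigma^{-i})=\sum_{s^{-i}}u^i(s^i,s^{-i})\prod_{k\in N_c\setminus\{i\}}\sigma^k(s^k)$. For $\lambda\ge 0$, $\sigma$ is a logit quantal response equilibrium (QRE) with parameter $\lambda$ if $$\sigma^i(s^i)=\frac{e^{\lambda u^i(s^i,\sigma^{-i})}}{\sum_{r\in S^i}e^{\lambda u^i(r,\sigma^{-i})}}\qquad(i\in N,\ s^i\in S^i).$$ *Sequence form.* For $i\in N$ let $\Lambda^i$ be the set of realization plans of $i$, that is, of the functions $\gamma^i:W^i\to[0,\infty)$ with $\gamma^i(\emptyset)=1$ and $\sum_{a\in A(I_i^j)}\gamma^i(\varpi^i_{I_i^j}a)=\gamma^i(\varpi^i_{I_i^j})$ for all $j\in M_i$; let $\gamma^c(\varpi^c)$ be the product of the chance probabilities along $\varpi^c$. For $\varpi\in\prod_{k\in N_c}W^k$ let $g^i(\varpi)=u^i_z(z)$ if there is a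 $z\in Z$ with $\varpi^k=\varpi^k_z$ for all $k\in N_c$, and $g^i(\varpi)=0$ otherwise, and let $g^i(\varpi^i,\gamma^{-i})=\sum_{\varpi^{-i}}g^i(\varpi^i,\varpi^{-i})\prod_{k\in N_c\setminus\{i\}}\gamma^k(\varpi^k)$. For $t\in(0,1]$, a profile $\gamma=(\gamma^i)_{i\in N}$ of realization plans is a Nash equilibrium of the perturbed game $\Gamma_s^e(t)$ if for every $i\in N$ the plan $\gamma^i$ maximizes $$(1-t)\sum_{j\in M_i}\sum_{a\in A(I_i^j)}\tilde\gamma^i(\varpi^i_{I_i^j}a)\,g^i(\varpi^i_{I_i^j}a,\gamma^{-i})-t\sum_{j\in M_i}\sum_{a\in A(I_i^j)}\tilde\gamma^i(\varpi^i_{I_i^j}a)\bigl(\ln\tilde\gamma^i(\varpi^i_{I_i^j}a)-\ln\tilde\gamma^i(\varpi^i_{I_i^j})\bigr)$$ over all $\tilde\gamma^i\in\Lambda^i$ (a summand of the second sum is $0$ if its factor $\tilde\gamma^i(\varpi^i_{I_i^j}a)$ is $0$). **Theorem.** Let $t\in(0,1]$ and $\lambda=(1-t)/t$. If the mixed strategy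 profile $\sigma$ is a logit QRE with parameter $\lambda$, then the profile $\gamma(\sigma)$ of realization plans given by $\gamma^i(\sigma^i;\varpi^i)=\sum_{s^i\in S^i}s^i(\varpi^i)\,\sigma^i(s^i)$, $i\in N$, $\varpi^i\in W^i$, is a Nash equilibrium of $\Gamma_s^e(t)$. -/

import Mathlib

noncomputable section

open scoped Classical

/-- The set `A(h)` of actions available after the history `h`, for a set `H` of histories.
A history `⟨a₁, …, a_L⟩` is stored with its latest action first, as the list `[a_L, …, a₁]`;
so `a :: h` is the history `h` followed by the action `a`. -/
def actionsAfter {A : Type*} (H : Finset (List A)) (h : List A) : Finset A :=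
  H.preimage (fun a => a :: h) (fun _ _ _ _ e => (List.cons.inj e).1)

theorem mem_actionsAfter {A : Type*} {H : Finset (List A)} {h : List A} {a : A} :
    a ∈ actionsAfter H h ↔ a :: h ∈ H :=
  Finset.mem_preimage

/-- A finite extensive-form game (with chance moves and information sets) with set of players `N`
and actions from `A`. The chance player is `none : Option N`, a player `i : N` is `some i`;
thus `Option N` is the set `N_c`. -/
structure ExtensiveGame (N A : Type*) where
  /-- the finite set of histories -/
  H : Finset (List A)
  nil_mem : [] ∈ H
  tail_mem : ∀ (a : A) (h : List A), a :: h ∈ H → h ∈ H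
  /-- the player who moves after a nonterminal history -/
  P : List A → Option N
  /-- `I h` is the information set that contains the nonterminal history `h` -/
  I : List A → Finset (List A)
  /-- the information sets of player `i` partition the nonterminal histories at which `i` moves -/
  mem_I : ∀ h : List A, (actionsAfter H h).Nonempty →
    ∀ h' : List A, h' ∈ I h ↔ ((actionsAfter H h').Nonempty ∧ P h' = P h ∧ I h' = I h)
  /-- the same actions are available at all histories of an information set -/
  actions_eq : ∀ h : List A, (actionsAfter H h).Nonempty →
    ∀ h' ∈ I h, actionsAfter H h' = actionsAfter H h
  /-- `fc J a` is the probability that chance takes the action `a` at its information set `J` -/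
  fc : Finset (List A) → A → ℝ
  fc_nonneg : ∀ h : List A, (actionsAfter H h).Nonempty → P h = none →
    ∀ a ∈ actionsAfter H h, 0 ≤ fc (I h) a
  fc_sum : ∀ h : List A, (actionsAfter H h).Nonempty → P h = none →
    ∑ a ∈ actionsAfter H h, fc (I h) a = 1
  /-- the payoffs of the players at the terminal histories -/
  u : N → List A → ℝ

namespace ExtensiveGame

variable {N A : Type*}

/-- A move: an information set together with an action taken there. -/
abbrev Move (A : Type*) := Finset (List A) × A

/-- A sequence of moves of one player, latest move first. -/
abbrev MoveSeq (A : Type*) := List (Move A)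

/-- A pure strategy, represented by the set of the moves that it prescribes. -/
abbrev MoveSet (A : Type*) := Finset (Move A)

/-- The set `Z` of terminal histories. -/
def terminal (G : ExtensiveGame N A) : Finset (List A) :=
  G.H.filter fun h => actionsAfter G.H h = ∅

/-- The collection of information sets of player `i`. -/
def infoSets (G : ExtensiveGame N A) (i : Option N) : Finset (Finset (List A)) :=
  (G.H.filter fun h => (actionsAfter G.H h).Nonempty ∧ G.P h = i).image G.I

/-- The set `A(J)` of actions available at an information set `J`. -/
def actions (G : ExtensiveGame N A) (J : Finset (List A)) : Finset A :=
  J.biUnion (actionsAfter G.H)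

/-- The record `ϖ^i_h` of player `i` along the history `h`: the information sets of `i` that are
passed along `h` together with the actions that `i` takes there, in order. -/
def record (G : ExtensiveGame N A) (i : Option N) : List A → MoveSeq A
  | [] => []
  | a :: h => if G.P h = i then (G.I h, a) :: G.record i h else G.record i h

/-- Perfect recall: for every player (chance included), histories in the same information set of
that player have the same record. -/
def PerfectRecall (G : ExtensiveGame N A) : Prop :=
  ∀ i : Option N, ∀ J ∈ G.infoSets i, ∀ h ∈ J, ∀ h' ∈ J, G.record i h = G.record i h'

/-- The sequence `ϖ^i_J` of player `i` that leads to the information set `J`: the record of `i`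
along any history in `J`. -/
def seqTo (G : ExtensiveGame N A) (i : Option N) (J : Finset (List A)) : MoveSeq A :=
  if hJ : J.Nonempty then G.record i hJ.choose else []

/-- The sequence `ϖ^i_J a`: the sequence leading to `J`, extended by the action `a` at `J`. -/
def ext (G : ExtensiveGame N A) (i : Option N) (J : Finset (List A)) (a : A) : MoveSeq A :=
  (J, a) :: G.seqTo i J

/-- The set `W^i` of sequences of player `i`. -/
def sequences (G : ExtensiveGame N A) (i : Option N) : Finset (MoveSeq A) :=
  insert [] ((G.infoSets i).biUnion fun J => (G.actions J).image (G.ext i J))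

/-! ### Reduced normal form -/

/-- All moves of player `i`. -/
def moves (G : ExtensiveGame N A) (i : Option N) : Finset (Move A) :=
  (G.infoSets i).biUnion fun J => (G.actions J).image fun a => (J, a)

/-- The set `S^i` of pure strategies of player `i` in the reduced normal form: a pure strategy
chooses exactly one action at every information set of `i` that its own earlier choices do not
exclude, and none at the information sets of `i` that they do exclude. -/
def pureStrategies (G : ExtensiveGame N A) (i : Option N) : Finset (MoveSet A) :=
  (G.moves i).powerset.filter fun s =>
    ∀ J ∈ G.infoSets i,
      ((∀ p ∈ G.seqTo i J, p ∈ s) → ∃! a, (J, a) ∈ s) ∧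
      (¬ (∀ p ∈ G.seqTo i J, p ∈ s) → ∀ a, (J, a) ∉ s)

/-- `s(a)` for a pure strategy `s` and a move: `1` if `s` prescribes the move, else `0`. -/
def choice (s : MoveSet A) (p : Move A) : ℝ := if p ∈ s then 1 else 0

/-- `s(ϖ)`, the product of `s(a)` over the moves of the sequence `ϖ`. -/
def choiceSeq (s : MoveSet A) (w : MoveSeq A) : ℝ := (w.map (choice s)).prod

/-- The product `∏ s^{P(a₁…a_q)}(a_{q+1})` along a history. -/
def reach (G : ExtensiveGame N A) (s : Option N → MoveSet A) : List A → ℝ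
  | [] => 1
  | a :: h => G.reach s h * choice (s (G.P h)) (G.I h, a)

/-- The payoff `u^i(s)` of player `i` at the pure strategy profile `s` (chance included). -/
def purePayoff (G : ExtensiveGame N A) (i : N) (s : Option N → MoveSet A) : ℝ :=
  ∑ h ∈ G.terminal, G.u i h * G.reach s h

/-- The mixed strategy `σ^c` of chance: the product of the chance probabilities of the moves that
a pure strategy of chance prescribes. -/
def chanceMixed (G : ExtensiveGame N A) (s : MoveSet A) : ℝ := ∏ p ∈ s, G.fc p.1 p.2

/-- A profile `σ = (σ^i : i ∈ N)`, completed by the mixed strategy of chance. -/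
def mixedWithChance (G : ExtensiveGame N A) (σ : N → MoveSet A → ℝ) :
    Option N → MoveSet A → ℝ
  | none => G.chanceMixed
  | some i => σ i

/-- `σ ∈ Ξ`: every `σ^i` is a probability distribution on `S^i`. -/
def IsMixedProfile (G : ExtensiveGame N A) (σ : N → MoveSet A → ℝ) : Prop :=
  ∀ i : N, (∀ s ∈ G.pureStrategies (some i), 0 ≤ σ i s) ∧
    ∑ s ∈ G.pureStrategies (some i), σ i s = 1

/-- `u^i(s^i, σ^{-i})`: the expected payoff of player `i` who plays `si` against `σ^{-i}` and
chance. The sum runs over all `s^{-i}`, that is, over all profiles `s` with `s^i = si`. -/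
def mixedPayoff [Fintype N] (G : ExtensiveGame N A) (i : N) (si : MoveSet A)
    (σ : N → MoveSet A → ℝ) : ℝ :=
  ∑ s ∈ (Fintype.piFinset G.pureStrategies).filter (fun s => s (some i) = si),
    G.purePayoff i s * ∏ k ∈ Finset.univ.erase (some i), G.mixedWithChance σ k (s k)

/-- `σ` is a logit quantal response equilibrium of the reduced normal form, with parameter `lam`. -/
def IsLogitQRE [Fintype N] (G : ExtensiveGame N A) (lam : ℝ) (σ : N → MoveSet A → ℝ) : Prop :=
  ∀ i : N, ∀ si ∈ G.pureStrategies (some i),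
    σ i si = Real.exp (lam * G.mixedPayoff i si σ) /
      ∑ si' ∈ G.pureStrategies (some i), Real.exp (lam * G.mixedPayoff i si' σ)

/-! ### Sequence form -/

/-- The payoff `g^i(ϖ)` at a sequence profile `ϖ`: it is `u^i(z)` if `ϖ` is defined by the
terminal history `z`, and `0` if `ϖ` is not defined by a terminal history. (Distinct terminal
histories define distinct sequence profiles.) -/
def seqPayoff (G : ExtensiveGame N A) (i : N) (w : Option N → MoveSeq A) : ℝ :=
  if hz : ∃ z ∈ G.terminal, ∀ k, w k = G.record k z then G.u i hz.choose else 0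

/-- `Λ^i`: the realization plans of player `i`. Only the values on `W^i` matter. -/
def realizationPlans (G : ExtensiveGame N A) (i : N) : Set (MoveSeq A → ℝ) :=
  {γ | γ [] = 1 ∧
    ∀ J ∈ G.infoSets (some i),
      ∑ a ∈ G.actions J, γ (G.ext (some i) J a) - γ (G.seqTo (some i) J) = 0 ∧
      ∀ a ∈ G.actions J, 0 ≤ γ (G.ext (some i) J a)}

/-- The realization plan `γ^c` of chance: the product of the chance probabilities along a
sequence. -/
def chancePlan (G : ExtensiveGame N A) (w : MoveSeq A) : ℝ :=
  (w.map fun p => G.fc p.1 p.2).prod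

/-- A profile `γ = (γ^i : i ∈ N)`, completed by the realization plan of chance. -/
def planWithChance (G : ExtensiveGame N A) (γ : N → MoveSeq A → ℝ) :
    Option N → MoveSeq A → ℝ
  | none => G.chancePlan
  | some i => γ i

/-- `g^i(ϖ^i, γ^{-i})`. The sum runs over all `ϖ^{-i}`, that is, over all sequence profiles `w`
with `w^i = wi`. -/
def planPayoff [Fintype N] (G : ExtensiveGame N A) (i : N) (wi : MoveSeq A)
    (γ : N → MoveSeq A → ℝ) : ℝ :=
  ∑ w ∈ (Fintype.piFinset G.sequences).filter (fun w => w (some i) = wi),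
    G.seqPayoff i w * ∏ k ∈ Finset.univ.erase (some i), G.planWithChance γ k (w k)

/-- The realization plan `γ^i(σ^i)` of a mixed strategy `σ^i`, for every player `i ∈ N`. -/
def realization (G : ExtensiveGame N A) (σ : N → MoveSet A → ℝ) : N → MoveSeq A → ℝ :=
  fun i w => ∑ s ∈ G.pureStrategies (some i), choiceSeq s w * σ i s

/-- The objective of player `i` in the perturbed game `Γ_s^e(t)`, as a function of `γi`, against
the profile `γhat`. In Lean `0 * (Real.log 0 - _) = 0`, which is the usual convention
`0 ln 0 = 0`. -/
def perturbedObjective [Fintype N] (G : ExtensiveGame N A) (t : ℝ) (i : N)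
    (γhat : N → MoveSeq A → ℝ) (γi : MoveSeq A → ℝ) : ℝ :=
  (1 - t) * ∑ J ∈ G.infoSets (some i), ∑ a ∈ G.actions J,
      γi (G.ext (some i) J a) * G.planPayoff i (G.ext (some i) J a) γhat
  - t * ∑ J ∈ G.infoSets (some i), ∑ a ∈ G.actions J,
      γi (G.ext (some i) J a) *
        (Real.log (γi (G.ext (some i) J a)) - Real.log (γi (G.seqTo (some i) J)))

/-- `γ` is a Nash equilibrium of `Γ_s^e(t)`: for every player `i`, `γ^i` maximizes the objective
of `i` against `γ^{-i}` over the realization plans of `i`. -/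
def IsPerturbedNash [Fintype N] (G : ExtensiveGame N A) (t : ℝ)
    (γ : N → MoveSeq A → ℝ) : Prop :=
  ∀ i : N, γ i ∈ G.realizationPlans i ∧
    IsMaxOn (G.perturbedObjective t i γ) (G.realizationPlans i) (γ i)

end ExtensiveGame

end

noncomputable section

open scoped Classical

namespace ExtensiveGame

variable {N A : Type*} {G : ExtensiveGame N A} {i : Option N}

/-! Fix a player and let `U` be `lam` times the sequence form payoff. Against fixed opponents, `lam`
times the payoff of a pure strategy is the sum of `U` over the sequences it chooses
(`mixedPayoff_eq_sum_planPayoff`). Perfect recall arranges the player's information sets in a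
forest, and backward induction with log-sum-exp gives a potential `V` on it for which `β (J, a) =
exp (U + ∑ V K - V J)`, with `K` ranging over the information sets reached directly by the extended
sequence, is a probability distribution at every `J` (`exists_logit_potential`). The potential
telescopes along any plan obeying the flow equations (`sum_mul_add_potential`). Along a pure
strategy this turns the logit weight into a constant times `∏ β`, so the QRE strategy mixes
independently with `β` and its realization plan multiplies `β` along sequences
(`sum_choiceSeq_mul_prod`). Along a realization plan it turns the perturbed objective, up to the
factor `t` and a constant, into a sum over `J` of weighted negative relative entropies with respect
to `β`. These are at most `0` (`mul_sub_log_le`), and all vanish at the plan generated by `β`. -/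

/-! ### Information sets and sequences under perfect recall. -/

theorem mem_H_of_nonempty {h : List A} (hne : (actionsAfter G.H h).Nonempty) : h ∈ G.H := by
  obtain ⟨a, ha⟩ := hne
  exact G.tail_mem a h (mem_actionsAfter.1 ha)

theorem self_mem_I {h : List A} (hne : (actionsAfter G.H h).Nonempty) : h ∈ G.I h :=
  (G.mem_I h hne h).2 ⟨hne, rfl, rfl⟩

theorem mem_infoSets {J : Finset (List A)} :
    J ∈ G.infoSets i ↔ ∃ h, (actionsAfter G.H h).Nonempty ∧ G.P h = i ∧ G.I h = J := by
  simp only [infoSets, Finset.mem_image, Finset.mem_filter]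
  constructor
  · rintro ⟨h, ⟨-, h1, h2⟩, h3⟩
    exact ⟨h, h1, h2, h3⟩
  · rintro ⟨h, h1, h2, h3⟩
    exact ⟨h, ⟨mem_H_of_nonempty h1, h1, h2⟩, h3⟩

theorem actions_I {h : List A} (hne : (actionsAfter G.H h).Nonempty) :
    G.actions (G.I h) = actionsAfter G.H h := by
  ext a
  simp only [actions, Finset.mem_biUnion]
  constructor
  · rintro ⟨h', h1, h2⟩
    rwa [G.actions_eq h hne h' h1] at h2
  · exact fun ha => ⟨h, self_mem_I hne, ha⟩

theorem actions_nonempty {J : Finset (List A)} (hJ : J ∈ G.infoSets i) :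
    (G.actions J).Nonempty := by
  obtain ⟨h, hne, -, rfl⟩ := mem_infoSets.1 hJ
  rwa [actions_I hne]

theorem seqTo_I (hG : G.PerfectRecall) {h : List A} (hne : (actionsAfter G.H h).Nonempty)
    (hi : G.P h = i) : G.seqTo i (G.I h) = G.record i h := by
  have hJ : (G.I h).Nonempty := ⟨h, self_mem_I hne⟩
  rw [seqTo, dif_pos hJ]
  exact hG i _ (mem_infoSets.2 ⟨h, hne, hi, rfl⟩) _ hJ.choose_spec _ (self_mem_I hne)

theorem mem_sequences {w : MoveSeq A} :
    w ∈ G.sequences i ↔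
      w = [] ∨ ∃ J ∈ G.infoSets i, ∃ a ∈ G.actions J, (J, a) :: G.seqTo i J = w := by
  simp [sequences, ext]

theorem nil_mem_sequences : [] ∈ G.sequences i := mem_sequences.2 (Or.inl rfl)

theorem ext_mem_sequences {J : Finset (List A)} (hJ : J ∈ G.infoSets i) {a : A}
    (ha : a ∈ G.actions J) : G.ext i J a ∈ G.sequences i :=
  mem_sequences.2 (Or.inr ⟨J, hJ, a, ha, rfl⟩)

theorem record_mem_sequences (hG : G.PerfectRecall) :
    ∀ {h : List A}, h ∈ G.H → G.record i h ∈ G.sequences i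
  | [], _ => nil_mem_sequences
  | a :: h, hh => by
    have ha : a ∈ actionsAfter G.H h := mem_actionsAfter.2 hh
    have hne : (actionsAfter G.H h).Nonempty := ⟨a, ha⟩
    rw [record]
    split_ifs with hi
    · rw [← seqTo_I hG hne hi]
      exact ext_mem_sequences (mem_infoSets.2 ⟨h, hne, hi, rfl⟩) (by rwa [actions_I hne])
    · exact record_mem_sequences hG (mem_H_of_nonempty hne)

theorem seqTo_mem_sequences (hG : G.PerfectRecall) {J : Finset (List A)}
    (hJ : J ∈ G.infoSets i) : G.seqTo i J ∈ G.sequences i := by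
  obtain ⟨h, hne, hi, rfl⟩ := mem_infoSets.1 hJ
  rw [seqTo_I hG hne hi]
  exact record_mem_sequences hG (mem_H_of_nonempty hne)

/-- Every move of a sequence is preceded in it by the sequence that leads to its information
set. -/
theorem suffix_of_mem_sequence (hG : G.PerfectRecall) :
    ∀ {w : MoveSeq A}, w ∈ G.sequences i → ∀ p ∈ w,
      p.1 ∈ G.infoSets i ∧ p.2 ∈ G.actions p.1 ∧ p :: G.seqTo i p.1 <:+ w
  | [], _, p, hp => by simp at hp
  | q :: w, hw, p, hp => by
    obtain h | ⟨J, hJ, a, ha, h⟩ := mem_sequences.1 hw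
    · simp at h
    · obtain ⟨rfl, rfl⟩ := List.cons.inj h
      rcases List.mem_cons.1 hp with rfl | hp
      · exact ⟨hJ, ha, List.suffix_refl _⟩
      · obtain ⟨h1, h2, h3⟩ :=
          suffix_of_mem_sequence hG (seqTo_mem_sequences hG hJ) p hp
        exact ⟨h1, h2, h3.trans (List.suffix_cons _ _)⟩

theorem eq_of_mem_sequence (hG : G.PerfectRecall) {w : MoveSeq A} (hw : w ∈ G.sequences i)
    {J : Finset (List A)} {a b : A} (ha : (J, a) ∈ w) (hb : (J, b) ∈ w) : a = b := by
  have h1 := (suffix_of_mem_sequence hG hw _ ha).2.2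
  have h2 := (suffix_of_mem_sequence hG hw _ hb).2.2
  -- Both suffixes have length one more than that of `G.seqTo i J`, so they coincide, heads
  -- included.
  have := (List.suffix_of_suffix_length_le h1 h2 (by simp)).eq_of_length (by simp)
  simpa using this

theorem nodup_of_mem_sequences (hG : G.PerfectRecall) :
    ∀ {w : MoveSeq A}, w ∈ G.sequences i → w.Nodup
  | [], _ => List.nodup_nil
  | q :: w, hw => by
    obtain h | ⟨J, hJ, a, ha, h⟩ := mem_sequences.1 hw
    · simp at h
    · obtain ⟨rfl, rfl⟩ := List.cons.inj h
      have hs := seqTo_mem_sequences hG hJ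
      refine List.nodup_cons.2 ⟨fun hm => ?_, nodup_of_mem_sequences hG hs⟩
      have := (suffix_of_mem_sequence hG hs _ hm).2.2.length_le
      simp at this

theorem mem_moves {p : Move A} :
    p ∈ G.moves i ↔ p.1 ∈ G.infoSets i ∧ p.2 ∈ G.actions p.1 := by
  simp only [moves, Finset.mem_biUnion, Finset.mem_image]
  constructor
  · rintro ⟨J, hJ, a, ha, rfl⟩
    exact ⟨hJ, ha⟩
  · exact fun h => ⟨p.1, h.1, p.2, h.2, rfl⟩

theorem choiceSeq_eq (s : MoveSet A) (w : MoveSeq A) :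
    choiceSeq s w = if ∀ p ∈ w, p ∈ s then 1 else 0 := by
  induction w with
  | nil => simp [choiceSeq]
  | cons p w ih =>
    have : choiceSeq s (p :: w) = choice s p * choiceSeq s w := by simp [choiceSeq]
    rw [this, ih, choice]
    by_cases h : p ∈ s <;> simp [h]

/-! ### Realization plans of products of behavioural probabilities -/

/-- The strategies that choose an action at every information set of player `i`. -/
def fullStrategies (G : ExtensiveGame N A) (i : Option N) :
    Finset ((J : ↥(G.infoSets i)) → A) :=
  Fintype.piFinset fun J => G.actions J.1

/-- The set of moves prescribed by a full strategy. -/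
def prescribed (f : ↥(G.infoSets i) → A) : MoveSet A :=
  Finset.univ.image fun J => (J.1, f J)

/-- The moves prescribed by a full strategy at information sets not excluded by itself. -/
def reduced (f : ↥(G.infoSets i) → A) : MoveSet A :=
  (prescribed f).filter fun p => ∀ q ∈ G.seqTo i p.1, q ∈ prescribed f

theorem mem_prescribed {f : ↥(G.infoSets i) → A} {J : Finset (List A)} {a : A} :
    (J, a) ∈ prescribed f ↔ ∃ hJ : J ∈ G.infoSets i, f ⟨J, hJ⟩ = a := by
  simp [prescribed]

/-- When actions are drawn independently with weights `β`, the event splits into one condition per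
information set: a prescribed action contributes its weight, an unconstrained set contributes `1`.
No sign of `β` is needed. -/
theorem sum_fullStrategies_of_subset {β : Move A → ℝ}
    (hβ : ∀ J ∈ G.infoSets i, ∑ a ∈ G.actions J, β (J, a) = 1) {T : MoveSet A}
    (hT : T ⊆ G.moves i) (hfun : ∀ J a b, (J, a) ∈ T → (J, b) ∈ T → a = b) :
    ∑ f ∈ G.fullStrategies i with T ⊆ prescribed f, ∏ J, β (J.1, f J) = ∏ p ∈ T, β p := by
  have h1 : ∀ f : ↥(G.infoSets i) → A, (if T ⊆ prescribed f then ∏ J, β (J.1, f J) else 0) =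
      ∏ J : ↥(G.infoSets i), if ∀ a, (J.1, a) ∈ T → a = f J then β (J.1, f J) else 0 := by
    intro f
    split_ifs with h
    · refine Finset.prod_congr rfl fun J _ => (if_pos fun a ha => ?_).symm
      obtain ⟨_, h⟩ := mem_prescribed.1 (h ha)
      exact h.symm
    · obtain ⟨⟨J, a⟩, hp, hn⟩ := Finset.not_subset.1 h
      have hJ := (mem_moves.1 (hT hp)).1
      refine (Finset.prod_eq_zero (Finset.mem_univ ⟨J, hJ⟩) (if_neg fun h => hn ?_)).symm
      exact mem_prescribed.2 ⟨hJ, (h a hp).symm⟩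
  have h2 : ∀ J ∈ G.infoSets i,
      (∑ a ∈ G.actions J, if ∀ b, (J, b) ∈ T → b = a then β (J, a) else 0) =
        ∏ p ∈ T with p.1 = J, β p := by
    intro J hJ
    by_cases h : ∃ a, (J, a) ∈ T
    · obtain ⟨a, ha⟩ := h
      have e : T.filter (fun p => p.1 = J) = {(J, a)} := by
        ext ⟨K, b⟩
        simp only [Finset.mem_filter, Finset.mem_singleton, Prod.mk.injEq]
        constructor
        · rintro ⟨hb, rfl⟩
          exact ⟨rfl, hfun _ _ _ hb ha⟩
        · rintro ⟨rfl, rfl⟩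
          exact ⟨ha, rfl⟩
      rw [e, Finset.prod_singleton, Finset.sum_eq_single a]
      · exact if_pos fun b hb => hfun _ _ _ hb ha
      · exact fun b _ hb => if_neg fun h => hb (h a ha).symm
      · exact fun hn => absurd (mem_moves.1 (hT ha)).2 hn
    · push Not at h
      rw [Finset.filter_eq_empty_iff.2 (fun p hp e => h p.2 (by rwa [← e])), Finset.prod_empty,
        ← hβ J hJ]
      exact Finset.sum_congr rfl fun a _ => if_pos fun b hb => absurd hb (h b)
  rw [Finset.sum_filter, Finset.sum_congr rfl fun f _ => h1 f, fullStrategies,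
    ← Finset.prod_univ_sum (fun J : ↥(G.infoSets i) => G.actions J.1)
      (fun J a => if ∀ b, (J.1, b) ∈ T → b = a then β (J.1, a) else 0),
    Finset.prod_coe_sort (G.infoSets i)
      (fun J => ∑ a ∈ G.actions J, if ∀ b, (J, b) ∈ T → b = a then β (J, a) else 0),
    Finset.prod_congr rfl h2]
  exact Finset.prod_fiberwise_of_maps_to (fun p hp => (mem_moves.1 (hT hp)).1) _

theorem subset_reduced_iff (hG : G.PerfectRecall) {f : ↥(G.infoSets i) → A} {w : MoveSeq A}
    (hw : w ∈ G.sequences i) :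
    (∀ p ∈ w, p ∈ reduced f) ↔ ∀ p ∈ w, p ∈ prescribed f := by
  constructor
  · exact fun h p hp => (Finset.mem_filter.1 (h p hp)).1
  · refine fun h p hp => Finset.mem_filter.2 ⟨h p hp, fun q hq => h q ?_⟩
    exact (suffix_of_mem_sequence hG hw p hp).2.2.subset (List.mem_cons_of_mem _ hq)

theorem reduced_mem_pureStrategies (hG : G.PerfectRecall) {f : ↥(G.infoSets i) → A}
    (hf : f ∈ G.fullStrategies i) : reduced f ∈ G.pureStrategies i := by
  rw [pureStrategies, Finset.mem_filter, Finset.mem_powerset]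
  refine ⟨fun ⟨J, a⟩ hp => ?_, fun J hJ => ?_⟩
  · obtain ⟨hJ, rfl⟩ := mem_prescribed.1 (Finset.mem_filter.1 hp).1
    exact mem_moves.2 ⟨hJ, Fintype.mem_piFinset.1 hf ⟨J, hJ⟩⟩
  · rw [subset_reduced_iff hG (seqTo_mem_sequences hG hJ)]
    refine ⟨fun h => ⟨f ⟨J, hJ⟩, ?_, fun a ha => ?_⟩, fun h a ha => ?_⟩
    · exact Finset.mem_filter.2 ⟨mem_prescribed.2 ⟨hJ, rfl⟩, h⟩
    · obtain ⟨_, h⟩ := mem_prescribed.1 (Finset.mem_filter.1 ha).1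
      exact h.symm
    · exact h (Finset.mem_filter.1 ha).2

theorem subset_moves_of_mem_pureStrategies {s : MoveSet A} (hs : s ∈ G.pureStrategies i) :
    s ⊆ G.moves i :=
  Finset.mem_powerset.1 (Finset.mem_filter.1 hs).1

theorem seqTo_subset_of_mem {s : MoveSet A} (hs : s ∈ G.pureStrategies i) {p : Move A}
    (hp : p ∈ s) : ∀ q ∈ G.seqTo i p.1, q ∈ s := by
  by_contra h
  exact ((Finset.mem_filter.1 hs).2 p.1
    (mem_moves.1 (subset_moves_of_mem_pureStrategies hs hp)).1).2 h p.2 hp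

theorem exists_mem_of_seqTo_subset {s : MoveSet A} (hs : s ∈ G.pureStrategies i)
    {J : Finset (List A)} (hJ : J ∈ G.infoSets i) (h : ∀ q ∈ G.seqTo i J, q ∈ s) :
    ∃! a, (J, a) ∈ s :=
  ((Finset.mem_filter.1 hs).2 J hJ).1 h

theorem eq_of_mem_pureStrategy {s : MoveSet A} (hs : s ∈ G.pureStrategies i)
    {J : Finset (List A)} {a b : A} (ha : (J, a) ∈ s) (hb : (J, b) ∈ s) : a = b :=
  (exists_mem_of_seqTo_subset hs (mem_moves.1 (subset_moves_of_mem_pureStrategies hs ha)).1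
    (seqTo_subset_of_mem hs ha)).unique ha hb

/-- Identifies the fibre of `reduced` over `s` with an event whose weight is `∏ p ∈ s, β p`. Where
`s` chooses, `f` agrees with it; by induction along a sequence, whatever `f` plays all along is then
played by `s`. -/
theorem reduced_eq_iff (hG : G.PerfectRecall) {s : MoveSet A} (hs : s ∈ G.pureStrategies i)
    {f : ↥(G.infoSets i) → A} : reduced f = s ↔ s ⊆ prescribed f := by
  constructor
  · rintro rfl
    exact Finset.filter_subset _ _
  intro h
  have key : ∀ w : MoveSeq A, w ∈ G.sequences i → (∀ p ∈ w, p ∈ prescribed f) →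
      ∀ p ∈ w, p ∈ s := by
    intro w
    induction w with
    | nil => simp
    | cons q w ih =>
      intro hw hwf
      obtain h' | ⟨J, hJ, a, ha, h'⟩ := mem_sequences.1 hw
      · simp at h'
      · obtain ⟨rfl, rfl⟩ := List.cons.inj h'
        have hs' := ih (seqTo_mem_sequences hG hJ) fun p hp => hwf p (List.mem_cons_of_mem _ hp)
        obtain ⟨b, hb, -⟩ := exists_mem_of_seqTo_subset hs hJ hs'
        obtain ⟨_, h1⟩ := mem_prescribed.1 (h hb)
        obtain ⟨_, h2⟩ := mem_prescribed.1 (hwf _ List.mem_cons_self)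
        have : b = a := h1.symm.trans h2
        subst this
        intro p hp
        rcases List.mem_cons.1 hp with rfl | hp
        · exact hb
        · exact hs' p hp
  ext ⟨J, a⟩
  rw [reduced, Finset.mem_filter]
  constructor
  · rintro ⟨h1, h2⟩
    obtain ⟨hJ, h3⟩ := mem_prescribed.1 h1
    obtain ⟨b, hb, -⟩ :=
      exists_mem_of_seqTo_subset hs hJ (key _ (seqTo_mem_sequences hG hJ) h2)
    obtain ⟨_, h4⟩ := mem_prescribed.1 (h hb)
    rwa [← h3, h4]
  · exact fun hp => ⟨h hp, fun q hq => h (seqTo_subset_of_mem hs hp q hq)⟩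

/-- The mixed strategy that mixes independently at the information sets with probabilities `β`
realizes every sequence with the product of the probabilities along it. -/
theorem sum_choiceSeq_mul_prod (hG : G.PerfectRecall) {β : Move A → ℝ}
    (hβ : ∀ J ∈ G.infoSets i, ∑ a ∈ G.actions J, β (J, a) = 1) {w : MoveSeq A}
    (hw : w ∈ G.sequences i) :
    ∑ s ∈ G.pureStrategies i, choiceSeq s w * ∏ p ∈ s, β p = (w.map β).prod := by
  -- The weight of `s` is the push-forward under `reduced` of the product weight on full strategies.
  have h1 : ∀ s ∈ G.pureStrategies i, choiceSeq s w * ∏ p ∈ s, β p =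
      ∑ f ∈ G.fullStrategies i with reduced f = s,
        choiceSeq (reduced f) w * ∏ J, β (J.1, f J) := by
    intro s hs
    rw [← sum_fullStrategies_of_subset hβ (subset_moves_of_mem_pureStrategies hs)
      (fun J a b => eq_of_mem_pureStrategy hs), Finset.mul_sum]
    simp only [← reduced_eq_iff hG hs]
    refine Finset.sum_congr rfl fun f hf => ?_
    rw [(Finset.mem_filter.1 hf).2]
  rw [Finset.sum_congr rfl h1, Finset.sum_fiberwise_of_maps_to
    (fun f hf => reduced_mem_pureStrategies hG hf)]
  have h2 : ∀ f : ↥(G.infoSets i) → A, choiceSeq (reduced f) w * ∏ J, β (J.1, f J) =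
      if w.toFinset ⊆ prescribed f then ∏ J, β (J.1, f J) else 0 := by
    intro f
    have : w.toFinset ⊆ prescribed f ↔ ∀ p ∈ w, p ∈ prescribed f := by
      simp [Finset.subset_iff]
    rw [choiceSeq_eq]
    simp only [subset_reduced_iff hG hw, this, ite_mul, one_mul, zero_mul]
  rw [Finset.sum_congr rfl fun f _ => h2 f, ← Finset.sum_filter,
    sum_fullStrategies_of_subset hβ, List.prod_toFinset _ (nodup_of_mem_sequences hG hw)]
  · intro p hp
    have := suffix_of_mem_sequence hG hw p (List.mem_toFinset.1 hp)
    exact mem_moves.2 ⟨this.1, this.2.1⟩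
  · exact fun J a b ha hb =>
      eq_of_mem_sequence hG hw (List.mem_toFinset.1 ha) (List.mem_toFinset.1 hb)

theorem chancePlan_eq (hG : G.PerfectRecall) {w : MoveSeq A} (hw : w ∈ G.sequences none) :
    ∑ s ∈ G.pureStrategies none, choiceSeq s w * G.chanceMixed s = G.chancePlan w := by
  refine sum_choiceSeq_mul_prod hG (β := fun p => G.fc p.1 p.2) (fun J hJ => ?_) hw
  obtain ⟨h, hne, hP, rfl⟩ := mem_infoSets.1 hJ
  rw [actions_I hne]
  exact G.fc_sum h hne hP

/-! ### Payoffs as sums over terminal histories -/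

theorem sum_piFinset_filter_prod_erase {ι κ : Type*} [Fintype ι] [DecidableEq ι]
    (S : ι → Finset κ) {j : ι} {x : κ} (hx : x ∈ S j) (φ : ι → κ → ℝ) :
    ∑ s ∈ Fintype.piFinset S with s j = x, ∏ k ∈ Finset.univ.erase j, φ k (s k) =
      ∏ k ∈ Finset.univ.erase j, ∑ y ∈ S k, φ k y := by
  -- With the factor at `j` set to `1` and `S j` shrunk to `{x}`, plain distributivity applies.
  have h1 : ∀ s : ι → κ, ∏ k ∈ Finset.univ.erase j, φ k (s k) =
      ∏ k, if k = j then 1 else φ k (s k) := by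
    intro s
    rw [← Finset.mul_prod_erase Finset.univ _ (Finset.mem_univ j), if_pos rfl, one_mul]
    exact Finset.prod_congr rfl fun k hk => (if_neg (Finset.ne_of_mem_erase hk)).symm
  rw [← Fintype.piFinset_update_singleton_eq_filter_piFinset_eq S j hx,
    Finset.sum_congr rfl fun s _ => h1 s,
    ← Finset.prod_univ_sum (Function.update S j {x})
      (fun k y => if k = j then 1 else φ k y),
    ← Finset.mul_prod_erase Finset.univ _ (Finset.mem_univ j)]
  simp only [Function.update_self, if_true, Finset.sum_singleton, one_mul]
  refine Finset.prod_congr rfl fun k hk => ?_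
  rw [Function.update_of_ne (Finset.ne_of_mem_erase hk)]
  exact Finset.sum_congr rfl fun y _ => if_neg (Finset.ne_of_mem_erase hk)

/-- Each move along a history belongs to the record of exactly one player. -/
theorem reach_eq_prod [Fintype N] (s : Option N → MoveSet A) :
    ∀ h : List A, G.reach s h = ∏ k, choiceSeq (s k) (G.record k h)
  | [] => by simp [reach, record, choiceSeq]
  | a :: h => by
    have : ∀ k, choiceSeq (s k) (G.record k (a :: h)) = choiceSeq (s k) (G.record k h) *
        if G.P h = k then choice (s k) (G.I h, a) else 1 := by
      intro k
      rw [record]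
      split_ifs
      · simp [choiceSeq, mul_comm]
      · rw [mul_one]
    rw [reach, reach_eq_prod s h, Finset.prod_congr rfl fun k _ => this k,
      Finset.prod_mul_distrib, Finset.prod_ite_eq, if_pos (Finset.mem_univ _)]

theorem record_suffix {k : Option N} :
    ∀ {h h' : List A}, h <:+ h' → G.record k h <:+ G.record k h'
  | h, [], hs => by rw [List.suffix_nil.1 hs]
  | h, a :: h', hs => by
    rcases List.suffix_cons_iff.1 hs with rfl | hs
    · exact List.suffix_refl _
    · refine (record_suffix hs).trans ?_
      rw [record]
      split_ifs
      · exact List.suffix_cons _ _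
      · exact List.suffix_refl _

theorem mem_H_of_suffix : ∀ {h h' : List A}, h <:+ h' → h' ∈ G.H → h ∈ G.H
  | h, [], hs, hh => by rwa [List.suffix_nil.1 hs]
  | h, a :: h', hs, hh => by
    rcases List.suffix_cons_iff.1 hs with rfl | hs
    · exact hh
    · exact mem_H_of_suffix hs (G.tail_mem _ _ hh)

/-- As histories are stored latest action first, suffixes are initial segments: two histories are
comparable or split after a common part `c`. -/
theorem suffix_or_branch {α : Type*} :
    ∀ (l m : List α), l <:+ m ∨ m <:+ l ∨
      ∃ (c : List α) (a b : α), a ≠ b ∧ a :: c <:+ l ∧ b :: c <:+ m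
  | [], m => Or.inl (List.nil_suffix)
  | x :: l, m => by
    rcases suffix_or_branch l m with ⟨t, ht⟩ | h | ⟨c, a, b, hab, h1, h2⟩
    · rcases List.eq_nil_or_concat t with rfl | ⟨t', y, rfl⟩
      · refine Or.inr (Or.inl ?_)
        rw [← ht]
        exact List.suffix_cons _ _
      · have hm : y :: l <:+ m := ⟨t', by simpa using ht⟩
        by_cases hxy : x = y
        · exact Or.inl (hxy ▸ hm)
        · exact Or.inr (Or.inr ⟨l, x, y, hxy, List.suffix_refl _, hm⟩)
    · exact Or.inr (Or.inl (h.trans (List.suffix_cons _ _)))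
    · exact Or.inr (Or.inr ⟨c, a, b, hab, h1.trans (List.suffix_cons _ _), h2⟩)

theorem eq_of_terminal_of_suffix {z z' : List A} (hz : z ∈ G.terminal) (hz' : z' ∈ G.terminal)
    (hs : z <:+ z') : z = z' := by
  obtain ⟨t, rfl⟩ := hs
  rcases List.eq_nil_or_concat t with rfl | ⟨t', y, rfl⟩
  · rfl
  · have hy : y :: z ∈ G.H :=
      mem_H_of_suffix ⟨t', by simp⟩ (Finset.mem_filter.1 hz').1
    have := mem_actionsAfter.2 hy
    rw [(Finset.mem_filter.1 hz).2] at this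
    simp at this

/-- Distinct terminal histories define distinct sequence profiles. -/
theorem eq_of_record_eq {z z' : List A} (hz : z ∈ G.terminal) (hz' : z' ∈ G.terminal)
    (h : ∀ k, G.record k z = G.record k z') : z = z' := by
  rcases suffix_or_branch z z' with hs | hs | ⟨c, a, b, hab, h1, h2⟩
  · exact eq_of_terminal_of_suffix hz hz' hs
  · exact (eq_of_terminal_of_suffix hz' hz hs).symm
  · have e1 := record_suffix (G := G) (k := G.P c) h1
    have e2 := record_suffix (G := G) (k := G.P c) h2
    rw [← h] at e2
    have := (List.suffix_of_suffix_length_le e1 e2 (by simp [record])).eq_of_length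
      (by simp [record])
    simp [record] at this
    exact absurd this hab

theorem seqPayoff_eq_sum {j : N} (w : Option N → MoveSeq A) :
    G.seqPayoff j w = ∑ z ∈ G.terminal, if w = fun k => G.record k z then G.u j z else 0 := by
  rw [seqPayoff]
  split_ifs with hz
  · obtain ⟨h1, h2⟩ := hz.choose_spec
    rw [Finset.sum_eq_single_of_mem _ h1, if_pos (funext h2)]
    intro z hz' hne
    refine if_neg fun h => hne (eq_of_record_eq hz' h1 fun k => ?_)
    rw [← h2 k, h]
  · refine (Finset.sum_eq_zero fun z hz' => if_neg fun h => hz ⟨z, hz', fun k => ?_⟩).symm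
    rw [h]

theorem planPayoff_eq_sum [Fintype N] (hG : G.PerfectRecall) (j : N) (v : MoveSeq A)
    (γ : N → MoveSeq A → ℝ) :
    G.planPayoff j v γ = ∑ z ∈ G.terminal, if G.record (some j) z = v then
      G.u j z * ∏ k ∈ Finset.univ.erase (some j), G.planWithChance γ k (G.record k z)
      else 0 := by
  simp only [planPayoff, seqPayoff_eq_sum, Finset.sum_mul]
  rw [Finset.sum_comm]
  refine Finset.sum_congr rfl fun z hz => ?_
  simp only [ite_mul, zero_mul]
  rw [Finset.sum_ite_eq']
  refine if_congr ?_ rfl rfl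
  rw [Finset.mem_filter, Fintype.mem_piFinset, and_iff_right]
  exact fun k => record_mem_sequences hG (Finset.mem_filter.1 hz).1

theorem sum_choiceSeq_mul_mixedWithChance (hG : G.PerfectRecall) (σ : N → MoveSet A → ℝ)
    (k : Option N) {w : MoveSeq A} (hw : w ∈ G.sequences k) :
    ∑ s ∈ G.pureStrategies k, choiceSeq s w * G.mixedWithChance σ k s =
      G.planWithChance (G.realization σ) k w := by
  cases k with
  | none => exact chancePlan_eq hG hw
  | some j => rfl

/-- The payoff of a pure strategy is the sum of the sequence form payoffs of the sequences that
the strategy chooses. -/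
theorem mixedPayoff_eq_sum_planPayoff [Fintype N] (hG : G.PerfectRecall) (j : N)
    {s : MoveSet A} (hs : s ∈ G.pureStrategies (some j)) (σ : N → MoveSet A → ℝ) :
    G.mixedPayoff j s σ = ∑ w ∈ G.sequences (some j),
      choiceSeq s w * G.planPayoff j w (G.realization σ) := by
  have hrec : ∀ z ∈ G.terminal, ∀ k, G.record k z ∈ G.sequences k := fun z hz k =>
    record_mem_sequences hG (Finset.mem_filter.1 hz).1
  have hL : G.mixedPayoff j s σ = ∑ z ∈ G.terminal,
      choiceSeq s (G.record (some j) z) * (G.u j z * ∏ k ∈ Finset.univ.erase (some j),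
        G.planWithChance (G.realization σ) k (G.record k z)) := by
    simp only [mixedPayoff, purePayoff, Finset.sum_mul]
    rw [Finset.sum_comm]
    refine Finset.sum_congr rfl fun z hz => ?_
    -- Each opponent's plan value is the probability that the opponent's strategy chooses the
    -- record; independence turns the product into a sum over profiles.
    rw [Finset.prod_congr rfl fun k _ =>
        (sum_choiceSeq_mul_mixedWithChance hG σ k (hrec z hz k)).symm,
      ← sum_piFinset_filter_prod_erase G.pureStrategies hs
        (fun k s => choiceSeq s (G.record k z) * G.mixedWithChance σ k s),
      Finset.mul_sum, Finset.mul_sum]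
    refine Finset.sum_congr (by congr) fun s' hs' => ?_
    have hs'' : s' (some j) = s := ((@Finset.mem_filter _ _ (_) _ _).1 hs').2
    rw [reach_eq_prod, ← Finset.mul_prod_erase Finset.univ _ (Finset.mem_univ (some j)),
      hs'', Finset.prod_mul_distrib]
    ring
  rw [hL]
  simp only [planPayoff_eq_sum hG, Finset.mul_sum]
  rw [Finset.sum_comm]
  refine Finset.sum_congr rfl fun z hz => ?_
  simp only [mul_ite, mul_zero]
  rw [Finset.sum_ite_eq, if_pos (hrec z hz _)]

/-! ### The logit potential of a decision tree -/

/-- The information sets of player `i` at which the sequence `w` has just been played. -/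
def nextInfoSets (G : ExtensiveGame N A) (i : Option N) (w : MoveSeq A) :
    Finset (Finset (List A)) :=
  (G.infoSets i).filter fun K => G.seqTo i K = w

theorem sum_sequences (F : MoveSeq A → ℝ) :
    ∑ w ∈ G.sequences i, F w =
      F [] + ∑ J ∈ G.infoSets i, ∑ a ∈ G.actions J, F (G.ext i J a) := by
  rw [sequences, Finset.sum_insert, Finset.sum_biUnion]
  · congr 1
    refine Finset.sum_congr rfl fun J _ => Finset.sum_image fun a _ b _ h => ?_
    simpa [ext] using h
  · intro J _ K _ hJK
    refine Finset.disjoint_left.2 fun w h1 h2 => hJK ?_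
    obtain ⟨a, -, rfl⟩ := Finset.mem_image.1 h1
    obtain ⟨b, -, h⟩ := Finset.mem_image.1 h2
    simp only [ext, List.cons.injEq, Prod.mk.injEq] at h
    exact h.1.1.symm
  · simp [ext]

/-- Every information set follows exactly one sequence, so this regroups the sum by that sequence.
-/
theorem sum_mul_nextInfoSets (hG : G.PerfectRecall) (c : MoveSeq A → ℝ)
    (V : Finset (List A) → ℝ) :
    ∑ w ∈ G.sequences i, c w * ∑ K ∈ G.nextInfoSets i w, V K =
      ∑ K ∈ G.infoSets i, c (G.seqTo i K) * V K := by
  rw [← Finset.sum_fiberwise_of_maps_to fun K hK => seqTo_mem_sequences hG hK]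
  refine Finset.sum_congr rfl fun w _ => ?_
  rw [Finset.mul_sum, nextInfoSets]
  refine Finset.sum_congr rfl fun K hK => ?_
  rw [(Finset.mem_filter.1 hK).2]

/-- The values of the information sets, computed by `n` steps of backward induction. -/
def logitValue (G : ExtensiveGame N A) (i : Option N) (U : MoveSeq A → ℝ) :
    ℕ → Finset (List A) → ℝ
  | 0, _ => 0
  | n + 1, J => Real.log (∑ a ∈ G.actions J, Real.exp (U (G.ext i J a) +
      ∑ K ∈ G.nextInfoSets i (G.ext i J a), G.logitValue i U n K))

/-- `V J` is the log-partition function of the decision tree below `J`; subtracting it normalizes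
the choice weights. -/
theorem exists_logit_potential (G : ExtensiveGame N A) (i : Option N) (U : MoveSeq A → ℝ) :
    ∃ V : Finset (List A) → ℝ, ∀ J ∈ G.infoSets i, ∑ a ∈ G.actions J,
      Real.exp (U (G.ext i J a) + ∑ K ∈ G.nextInfoSets i (G.ext i J a), V K - V J) = 1 := by
  let M := (G.infoSets i).sup fun J => (G.seqTo i J).length
  -- The step count drops by one from `J` to each successor and is at least `1` at every information
  -- set, so the base value `0` never enters.
  refine ⟨fun J => G.logitValue i U (M + 1 - (G.seqTo i J).length) J, fun J hJ => ?_⟩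
  have hM : (G.seqTo i J).length ≤ M :=
    Finset.le_sup (f := fun J => (G.seqTo i J).length) hJ
  have h1 : M + 1 - (G.seqTo i J).length = (M - (G.seqTo i J).length) + 1 := by omega
  have h2 : ∀ a, ∑ K ∈ G.nextInfoSets i (G.ext i J a),
      G.logitValue i U (M + 1 - (G.seqTo i K).length) K =
      ∑ K ∈ G.nextInfoSets i (G.ext i J a),
        G.logitValue i U (M - (G.seqTo i J).length) K := by
    intro a
    refine Finset.sum_congr rfl fun K hK => ?_
    rw [(Finset.mem_filter.1 hK).2, ext, List.length_cons, Nat.add_sub_add_right]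
  have hpos : 0 < ∑ a ∈ G.actions J, Real.exp (U (G.ext i J a) +
      ∑ K ∈ G.nextInfoSets i (G.ext i J a),
        G.logitValue i U (M - (G.seqTo i J).length) K) :=
    Finset.sum_pos (fun _ _ => Real.exp_pos _) (actions_nonempty hJ)
  simp only [h2, Real.exp_sub, ← Finset.sum_div]
  rw [h1, logitValue, Real.exp_log hpos, div_self hpos.ne']

/-- The telescoping of a potential along a function that satisfies the conservation laws of a
realization plan. -/
theorem sum_mul_add_potential (hG : G.PerfectRecall) {c : MoveSeq A → ℝ} (hc0 : c [] = 1)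
    (hc : ∀ J ∈ G.infoSets i, ∑ a ∈ G.actions J, c (G.ext i J a) = c (G.seqTo i J))
    (U : MoveSeq A → ℝ) (V : Finset (List A) → ℝ) :
    ∑ J ∈ G.infoSets i, ∑ a ∈ G.actions J, c (G.ext i J a) *
        (U (G.ext i J a) + ∑ K ∈ G.nextInfoSets i (G.ext i J a), V K - V J) =
      ∑ J ∈ G.infoSets i, ∑ a ∈ G.actions J, c (G.ext i J a) * U (G.ext i J a) -
        ∑ K ∈ G.nextInfoSets i [], V K := by
  -- `V K` enters positively with the inflow of `K` and negatively with its outflow; only sets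
  -- following the empty sequence lack the positive term.
  have h := sum_mul_nextInfoSets (i := i) hG c V
  rw [sum_sequences, hc0, one_mul] at h
  have h2 : ∑ J ∈ G.infoSets i, ∑ a ∈ G.actions J, c (G.ext i J a) * V J =
      ∑ J ∈ G.infoSets i, c (G.seqTo i J) * V J :=
    Finset.sum_congr rfl fun J hJ => by rw [← Finset.sum_mul, hc J hJ]
  simp only [mul_sub, mul_add, Finset.sum_sub_distrib, Finset.sum_add_distrib]
  linarith

/-! ### Pure strategies as 0-1 realization plans. -/

theorem choiceSeq_ext {s : MoveSet A} (hs : s ∈ G.pureStrategies i) (J : Finset (List A))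
    (a : A) : choiceSeq s (G.ext i J a) = if (J, a) ∈ s then 1 else 0 := by
  rw [choiceSeq_eq]
  refine if_congr ⟨fun h => h _ List.mem_cons_self, fun h p hp => ?_⟩ rfl rfl
  rcases List.mem_cons.1 hp with rfl | hp
  · exact h
  · exact seqTo_subset_of_mem hs h p hp

theorem sum_choiceSeq_ext {s : MoveSet A} (hs : s ∈ G.pureStrategies i)
    {J : Finset (List A)} (hJ : J ∈ G.infoSets i) :
    ∑ a ∈ G.actions J, choiceSeq s (G.ext i J a) = choiceSeq s (G.seqTo i J) := by
  simp only [choiceSeq_ext hs]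
  rw [choiceSeq_eq]
  split_ifs with h
  · obtain ⟨a, ha, hu⟩ := exists_mem_of_seqTo_subset hs hJ h
    rw [Finset.sum_eq_single_of_mem a
      (mem_moves.1 (subset_moves_of_mem_pureStrategies hs ha)).2, if_pos ha]
    exact fun b _ hb => if_neg fun h => hb (hu b h)
  · exact Finset.sum_eq_zero fun a _ => if_neg fun ha => h (seqTo_subset_of_mem hs ha)

theorem sum_pureStrategy {s : MoveSet A} (hs : s ∈ G.pureStrategies i) (F : Move A → ℝ) :
    ∑ p ∈ s, F p =
      ∑ J ∈ G.infoSets i, ∑ a ∈ G.actions J, choiceSeq s (G.ext i J a) * F (J, a) := by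
  simp only [choiceSeq_ext hs, ite_mul, one_mul, zero_mul]
  have h : ∑ p ∈ s, F p = ∑ p ∈ G.moves i, if p ∈ s then F p else 0 := by
    rw [← Finset.sum_filter, Finset.filter_mem_eq_inter,
      Finset.inter_eq_right.2 (subset_moves_of_mem_pureStrategies hs)]
  rw [h, moves, Finset.sum_biUnion]
  · exact Finset.sum_congr rfl fun J _ => Finset.sum_image fun a _ b _ h => (Prod.mk.inj h).2
  · intro J _ K _ hJK
    refine Finset.disjoint_left.2 fun w h1 h2 => hJK ?_
    obtain ⟨a, -, rfl⟩ := Finset.mem_image.1 h1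
    obtain ⟨b, -, h⟩ := Finset.mem_image.1 h2
    exact (Prod.mk.inj h).1.symm

/-- A distribution on the pure strategies that is proportional to the exponential of an additive
payoff realizes sequences with logit choice probabilities at the information sets. -/
theorem sum_choiceSeq_mul_logit (hG : G.PerfectRecall) {U : MoveSeq A → ℝ}
    {V : Finset (List A) → ℝ} {β : Move A → ℝ}
    (hβ : ∀ J a, β (J, a) =
      Real.exp (U (G.ext i J a) + ∑ K ∈ G.nextInfoSets i (G.ext i J a), V K - V J))
    (hβ1 : ∀ J ∈ G.infoSets i, ∑ a ∈ G.actions J, β (J, a) = 1) {w : MoveSeq A}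
    (hw : w ∈ G.sequences i) :
    ∑ s ∈ G.pureStrategies i, choiceSeq s w *
      (Real.exp (∑ v ∈ G.sequences i, choiceSeq s v * U v) /
        ∑ r ∈ G.pureStrategies i, Real.exp (∑ v ∈ G.sequences i, choiceSeq r v * U v)) =
      (w.map β).prod := by
  have h1 : ∀ s ∈ G.pureStrategies i, Real.exp (∑ v ∈ G.sequences i, choiceSeq s v * U v) =
      Real.exp (U [] + ∑ K ∈ G.nextInfoSets i [], V K) * ∏ p ∈ s, β p := by
    intro s hs
    have h := sum_mul_add_potential (c := choiceSeq s) hG (by simp [choiceSeq])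
      (fun J hJ => sum_choiceSeq_ext hs hJ) U V
    have hlog : ∀ J a, Real.log (β (J, a)) =
        U (G.ext i J a) + ∑ K ∈ G.nextInfoSets i (G.ext i J a), V K - V J :=
      fun J a => by rw [hβ, Real.log_exp]
    have h' := sum_pureStrategy hs fun p => Real.log (β p)
    rw [Finset.sum_congr rfl fun J _ => Finset.sum_congr rfl fun a _ => by rw [hlog], h] at h'
    have h0 : choiceSeq s [] = 1 := by simp [choiceSeq]
    rw [Finset.prod_congr rfl fun p (_ : p ∈ s) =>
        (Real.exp_log (show 0 < β p by rw [← Prod.mk.eta (p := p), hβ]; exact Real.exp_pos _)).symm,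
      ← Real.exp_sum, h', ← Real.exp_add, sum_sequences, h0, one_mul]
    congr 1
    ring
  -- At the empty sequence the product weights sum to `1`, so the common constant is the logit
  -- denominator.
  have h2 : ∑ r ∈ G.pureStrategies i,
      Real.exp (∑ v ∈ G.sequences i, choiceSeq r v * U v) =
      Real.exp (U [] + ∑ K ∈ G.nextInfoSets i [], V K) := by
    have := sum_choiceSeq_mul_prod hG hβ1 (nil_mem_sequences (G := G) (i := i))
    simp only [choiceSeq, List.map_nil, List.prod_nil, one_mul] at this
    rw [Finset.sum_congr rfl h1, ← Finset.mul_sum, this, mul_one]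
  rw [h2, ← sum_choiceSeq_mul_prod hG hβ1 hw]
  refine Finset.sum_congr rfl fun s hs => ?_
  rw [h1 s hs, mul_div_cancel_left₀ _ (Real.exp_pos _).ne']

/-! ### Relative entropy and the perturbed objective. -/

/-- Gibbs' inequality for one action: `log r ≤ r - 1` at `r = exp l * y / x`. At `x = 0` the factor
`x` cancels the default values of `log`. -/
theorem mul_sub_log_le {x y l : ℝ} (hx : 0 ≤ x) (hy : x ≤ y) :
    x * (l - (Real.log x - Real.log y)) ≤ Real.exp l * y - x := by
  rcases hx.eq_or_lt with rfl | hx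
  · simpa using mul_nonneg (Real.exp_pos l).le hy
  · have hy' : 0 < y := hx.trans_le hy
    have h := Real.log_le_sub_one_of_pos (div_pos (mul_pos (Real.exp_pos l) hy') hx)
    rw [Real.log_div (mul_pos (Real.exp_pos l) hy').ne' hx.ne',
      Real.log_mul (Real.exp_pos l).ne' hy'.ne', Real.log_exp] at h
    calc x * (l - (Real.log x - Real.log y))
        ≤ x * (Real.exp l * y / x - 1) := mul_le_mul_of_nonneg_left (by linarith) hx.le
      _ = Real.exp l * y - x := by field_simp

/-- The objective of the perturbed game in terms of a logit potential. -/
theorem perturbedObjective_eq [Fintype N] (hG : G.PerfectRecall) {t lam : ℝ} (ht : 0 < t)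
    (hlam : lam = (1 - t) / t) (j : N) (γ : N → MoveSeq A → ℝ) {c : MoveSeq A → ℝ}
    (hc : c ∈ G.realizationPlans j) (V : Finset (List A) → ℝ) :
    G.perturbedObjective t j γ c = t * (∑ J ∈ G.infoSets (some j), ∑ a ∈ G.actions J,
        c (G.ext (some j) J a) *
          ((lam * G.planPayoff j (G.ext (some j) J a) γ +
              ∑ K ∈ G.nextInfoSets (some j) (G.ext (some j) J a), V K - V J) -
            (Real.log (c (G.ext (some j) J a)) - Real.log (c (G.seqTo (some j) J)))) +
      ∑ K ∈ G.nextInfoSets (some j) [], V K) := by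
  have h := sum_mul_add_potential hG hc.1 (fun J hJ => sub_eq_zero.1 (hc.2 J hJ).1)
    (fun w => lam * G.planPayoff j w γ) V
  -- The choice of `lam` makes `t` a common factor of payoff and entropy terms.
  have h1 : 1 - t = t * lam := by rw [hlam, mul_div_cancel₀ _ ht.ne']
  simp only [mul_sub (c _) (_ - _) _, Finset.sum_sub_distrib]
  rw [h, perturbedObjective, h1]
  have h2 : ∑ J ∈ G.infoSets (some j), ∑ a ∈ G.actions J,
      c (G.ext (some j) J a) * (lam * G.planPayoff j (G.ext (some j) J a) γ) =
      lam * ∑ J ∈ G.infoSets (some j), ∑ a ∈ G.actions J,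
        c (G.ext (some j) J a) * G.planPayoff j (G.ext (some j) J a) γ := by
    simp only [Finset.mul_sum, mul_left_comm]
  rw [h2]
  ring

end ExtensiveGame

end

/-! ### The QRE plan maximizes the perturbed objective. -/

theorem theorem2 {N A : Type*} [Fintype N] (G : ExtensiveGame N A) (hG : G.PerfectRecall)
    (t : ℝ) (ht0 : 0 < t) (ht1 : t ≤ 1) (lam : ℝ) (hlam : lam = (1 - t) / t)
    (σ : N → ExtensiveGame.MoveSet A → ℝ) (hσ : G.IsMixedProfile σ)
    (hqre : G.IsLogitQRE lam σ) :
    G.IsPerturbedNash t (G.realization σ) := by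
  open ExtensiveGame in
  intro j
  set U : MoveSeq A → ℝ := fun w => lam * G.planPayoff j w (G.realization σ) with hU
  obtain ⟨V, hV⟩ := exists_logit_potential G (some j) U
  set l : Finset (List A) → A → ℝ := fun J a => U (G.ext (some j) J a) +
    ∑ K ∈ G.nextInfoSets (some j) (G.ext (some j) J a), V K - V J
  have hpay : ∀ s ∈ G.pureStrategies (some j), lam * G.mixedPayoff j s σ =
      ∑ v ∈ G.sequences (some j), choiceSeq s v * U v := by
    intro s hs
    simp only [mixedPayoff_eq_sum_planPayoff hG j hs, Finset.mul_sum, hU, mul_left_comm]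
  have hreal : ∀ w ∈ G.sequences (some j), G.realization σ j w =
      (w.map fun p => Real.exp (l p.1 p.2)).prod := by
    intro w hw
    rw [← sum_choiceSeq_mul_logit hG (fun _ _ => rfl) hV hw, realization]
    refine Finset.sum_congr rfl fun s hs => ?_
    rw [hqre j s hs, hpay s hs]
    congr 2
    exact Finset.sum_congr rfl fun r hr => by rw [hpay r hr]
  have hext : ∀ J ∈ G.infoSets (some j), ∀ a ∈ G.actions J,
      G.realization σ j (G.ext (some j) J a) =
        Real.exp (l J a) * G.realization σ j (G.seqTo (some j) J) := by
    intro J hJ a ha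
    rw [hreal _ (ext_mem_sequences hJ ha), hreal _ (seqTo_mem_sequences hG hJ)]
    simp [ext]
  have hpos : ∀ w ∈ G.sequences (some j), 0 < G.realization σ j w := by
    intro w hw
    rw [hreal w hw]
    refine List.prod_pos fun x hx => ?_
    obtain ⟨p, -, rfl⟩ := List.mem_map.1 hx
    exact Real.exp_pos _
  have hmem : G.realization σ j ∈ G.realizationPlans j := by
    refine ⟨by simp [hreal _ nil_mem_sequences], fun J hJ => ⟨?_, fun a ha => ?_⟩⟩
    · rw [Finset.sum_congr rfl (hext J hJ), ← Finset.sum_mul, hV J hJ, one_mul, sub_self]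
    · exact (hpos _ (ext_mem_sequences hJ ha)).le
  refine ⟨hmem, fun c hc => ?_⟩
  rw [Set.mem_ofPred_eq, perturbedObjective_eq hG ht0 hlam j _ hc V,
    perturbedObjective_eq hG ht0 hlam j _ hmem V]
  refine mul_le_mul_of_nonneg_left (add_le_add_left ?_ _) ht0.le
  -- Summed over the actions at `J`, the bounds cancel: `exp (l J a)` sums to `1`, and the plan
  -- conserves flow.
  have hle : ∀ J ∈ G.infoSets (some j), ∑ a ∈ G.actions J, c (G.ext (some j) J a) *
      (l J a - (Real.log (c (G.ext (some j) J a)) - Real.log (c (G.seqTo (some j) J)))) ≤ 0 := by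
    intro J hJ
    obtain ⟨hsum, hnn⟩ := hc.2 J hJ
    rw [sub_eq_zero] at hsum
    calc _ ≤ ∑ a ∈ G.actions J, (Real.exp (l J a) * c (G.seqTo (some j) J) -
          c (G.ext (some j) J a)) := Finset.sum_le_sum fun a ha =>
            mul_sub_log_le (hnn a ha) (hsum ▸ Finset.single_le_sum hnn ha)
      _ = 0 := by
        rw [Finset.sum_sub_distrib, ← Finset.sum_mul, hV J hJ, hsum, one_mul, sub_self]
  -- Here the conditional choice probabilities are exactly `exp (l J a)`, so each summand vanishes.
  have heq : ∀ J ∈ G.infoSets (some j), ∑ a ∈ G.actions J,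
      G.realization σ j (G.ext (some j) J a) *
      (l J a - (Real.log (G.realization σ j (G.ext (some j) J a)) -
        Real.log (G.realization σ j (G.seqTo (some j) J)))) = 0 := by
    intro J hJ
    refine Finset.sum_eq_zero fun a ha => ?_
    rw [hext J hJ a ha, Real.log_mul (Real.exp_pos _).ne'
      (hpos _ (seqTo_mem_sequences hG hJ)).ne', Real.log_exp]
    ring
  exact (Finset.sum_nonpos hle).trans_eq (Finset.sum_eq_zero heq).symm
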